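/- Let $N,k,h$ be positive integers with $h\le k\le N$, and let $\mu,\sigma>0$. A pair $(S,E)$ is drawn under the 2-community weighted stochastic block model 2-hWSBM$(\mu,\sigma,N,k,h)$ on the complete $h$-uniform hypergraph with vertex set $\{1,\dots,N\}$ if $S$ is a uniformly random $k$-element set of vertices and, given $S$, the weights $E_e$, one for every $h$-element set $e$ of vertices, are independent Gaussians of variance $\sigma^2$, with mean $\mu$ if $e\subseteq S$ and mean $0$ otherwise. Theorem. Consider sequences $k=k_N$, $h=h_N$ of integers with $2\le h\le k\le N$ for all large $N$, and positive sequences $\hat\mu=\hat\mu_N$, $\hat\sigma=\hat\sigma_N$ (for example constants), and put $\gamma=\hat\mu/\hat\sigma$. For each $N$ let $(S,E)$ be drawn under 2-hWSBM$(\hat\mu\log N,\ \hat\sigma\sqrt{\log N/2},\ N,k,h)$. Exact recovery is called solvable if there are estimators $\hat S=\hat S(E)$ with $\mathbb P[\hat S=S]\to 1$ as $N\to\infty$, and unsolvable otherwise. (a) If $k<N$ and $\gamma<\gamma_-:=\sqrt{1/\binom{k-1}{h-1}}$ for all large $N$, then exact recovery is unsolvable. (b) If $\gamma>\gamma_+$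 for all large $N$, then exact recovery is solvable, in each of the following regimes, with the corresponding upper threshold $\gamma_+$: (i) $\frac1h\binom{k-1}{h-1}=o(\log N)$, with $\gamma_+=2\sqrt{\dfrac{h/2}{\binom{k-1}{h-1}}}$; (ii) $\frac1h\binom{k-1}{h-1}/\log N\to c$ with $c\in(0,+\infty]$, with $\gamma_+=2\sqrt{\dfrac{1+\log 2+1/c}{\log N}}$ (where $1/c=0$ if $c=+\infty$); (iii) $k=O(N^\alpha)$ with a constant $0<\alpha<1$, and $\log N=o\big(\frac1h\binom{k-1}{h-1}\big)$, with $\gamma_+=2\sqrt{\dfrac{1+\log 2}{(1-\alpha)\log N}}$. -/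

import Mathlib

open Filter Topology MeasureTheory ProbabilityTheory Asymptotics

/-- The hyperedges of the complete `h`-uniform hypergraph on the vertex set `Fin N`:
the `h`-element sets of vertices. -/
abbrev Hyperedge (N h : ℕ) : Type := {e : Finset (Fin N) // e.card = h}

/-- The conditional law of the hyperedge weights given that the planted community is `S`:
the weights are independent Gaussians of variance `σ ^ 2`, and the mean is `μ` for the hyperedges
all of whose vertices lie in `S`, and `0` for all the other ones. -/
noncomputable def weightLaw (N h : ℕ) (μ σ : ℝ) (S : Finset (Fin N)) :
    Measure (Hyperedge N h → ℝ) :=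
  Measure.pi fun e => gaussianReal (if e.1 ⊆ S then μ else 0) (Real.toNNReal (σ ^ 2))

/-- The 2-hWSBM with parameters `(μ, σ, N, k, h)`, as the joint law of the pair `(S, E)`:
`S` is uniform among the `k`-element vertex sets, and given `S` the weights `E` follow
`weightLaw N h μ σ S`. -/
noncomputable def hWSBM (μ σ : ℝ) (N k h : ℕ) :
    Measure (Finset (Fin N) × (Hyperedge N h → ℝ)) :=
  ((N.choose k : ENNReal)⁻¹) •
    ∑ S ∈ (Finset.univ : Finset (Fin N)).powersetCard k,
      (Measure.dirac S).prod (weightLaw N h μ σ S)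

/-- Exact recovery is solvable, along the sequence of models with parameters
`(μ N, σ N, N, k N, h N)`, if some (measurable) estimator of the planted community
from the hyperedge weights is correct with probability `1 - o(1)` as `N → ∞`. -/
def ExactRecoverySolvable (μ σ : ℕ → ℝ) (k h : ℕ → ℕ) : Prop :=
  ∃ Shat : ∀ N : ℕ, (Hyperedge N (h N) → ℝ) → Finset (Fin N),
    (∀ N, Measurable (Shat N)) ∧
    Tendsto
      (fun N : ℕ => (hWSBM (μ N) (σ N) N (k N) (h N)).real {p | p.1 = Shat N p.2})
      atTop (𝓝 1)

/-! Write `d = C(k-1, h-1)`, the number of hyperedges inside the community through one of its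
vertices.

Unsolvability is a change of measure. The `k`-sets are gathered into families whose laws are all
close to one reference law: the `k`-sets containing a fixed `(k-1)`-set if `2k ≤ N`, the `k`-subsets
of a fixed `(k+1)`-set otherwise. The log-likelihood ratio against the reference is `N(D/2, D)` with
`D ≤ d μ²/σ²`, which is at most `2 log N` below the lower threshold. Under the reference the events
`Shat = S` are disjoint, and every family has at least `N/2` members, so the success probability is
at most `2 exp s / N + P(ratio > s)` (`hWSBM_real_le`). With `s = log N - C` this stays below a
constant smaller than 1.

Solvability comes from maximising the inner weight. A competitor sharing `j` vertices with `S` wins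
with probability `P(Z ≤ -x)`, where `x²/2 = (C(k,h) - C(j,h)) μ²/(4σ²)`. The Mills ratio contributes
a factor of order `1/√(log N)` beyond the exponential, so the union bound need only be bounded
without that factor (`exactRecoverySolvable_of_sum_le`). There are at most `C(k,k-j) C(N-k,k-j)`
such competitors, and the gap `C(k,h) - C(j,h)` is at least `(k-j) d/h`, improving to `(k-j+1) d/h`
for `j ≥ 1`. If `(d/h) μ²/(4σ²) ≥ 2 log N` the first bound suffices, which covers regimes (ii) and
(iii). In regime (i) only `log N` is available: there the second bound, Vandermonde's identity for
small overlaps and the smallness of `d/h` are needed. -/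

/-! ### Gaussian product measures: linear images, change of measure, tails -/

/-- A linear functional of independent Gaussians of common variance is Gaussian. -/
theorem map_linear_pi_gaussianReal {ι : Type*} [Fintype ι] (m a : ι → ℝ) (v : NNReal) :
    (Measure.pi fun i => gaussianReal (m i) v).map (fun x => ∑ i, a i * x i) =
      gaussianReal (∑ i, a i * m i) (v * Real.toNNReal (∑ i, a i ^ 2)) := by
  have hmeas : Measurable (fun x : ι → ℝ => ∑ i, a i * x i) := by fun_prop
  have := Measure.isProbabilityMeasure_map (μ := Measure.pi fun i => gaussianReal (m i) v)
    hmeas.aemeasurable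
  apply Measure.ext_of_charFun
  ext t
  rw [charFun_gaussianReal, charFun_apply_real, integral_map hmeas.aemeasurable (by fun_prop)]
  have h1 : ∀ x : ι → ℝ, Complex.exp (t * ((∑ i, a i * x i : ℝ) : ℂ) * Complex.I) =
      ∏ i, Complex.exp (((t * a i : ℝ) : ℂ) * (x i : ℂ) * Complex.I) := by
    intro x
    rw [← Complex.exp_sum]
    congr 1
    push_cast
    rw [Finset.mul_sum, Finset.sum_mul]
    exact Finset.sum_congr rfl fun i _ => by ring
  simp_rw [h1]
  rw [integral_fintype_prod_eq_prod (μ := fun i => gaussianReal (m i) v)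
    (fun i (y : ℝ) => Complex.exp (((t * a i : ℝ) : ℂ) * (y : ℂ) * Complex.I))]
  simp_rw [← charFun_apply_real, charFun_gaussianReal]
  rw [← Complex.exp_sum]
  congr 1
  have h0 : 0 ≤ ∑ i, a i ^ 2 := Finset.sum_nonneg fun i _ => sq_nonneg _
  rw [NNReal.coe_mul, Real.coe_toNNReal _ h0]
  push_cast
  rw [Finset.sum_sub_distrib, Finset.mul_sum, Finset.sum_mul, Finset.mul_sum, Finset.sum_mul,
    Finset.sum_div]
  congr 1 <;> exact Finset.sum_congr rfl fun i _ => by ring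

theorem gaussianReal_withDensity_gaussianReal (m m' : ℝ) {v : NNReal} (hv : v ≠ 0) :
    (gaussianReal m' v).withDensity
      (fun x => ENNReal.ofReal (Real.exp ((m - m') / v * x - (m ^ 2 - m' ^ 2) / (2 * v)))) =
      gaussianReal m v := by
  rw [gaussianReal_of_var_ne_zero _ hv, gaussianReal_of_var_ne_zero _ hv,
    ← withDensity_mul _ (measurable_gaussianPDF m' v) (by fun_prop)]
  congr 1
  ext x
  have hv' : (v : ℝ) ≠ 0 := by exact_mod_cast hv
  rw [Pi.mul_apply, gaussianPDF_def, gaussianPDF_def,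
    ← ENNReal.ofReal_mul (gaussianPDFReal_nonneg _ _ _)]
  congr 1
  rw [gaussianPDFReal_def, gaussianPDFReal_def, mul_assoc, ← Real.exp_add]
  congr 2
  field_simp
  ring

theorem pi_withDensity {ι : Type*} [Fintype ι] {X : ι → Type*} [∀ i, MeasurableSpace (X i)]
    (q : ∀ i, Measure (X i)) [∀ i, IsProbabilityMeasure (q i)]
    (f : ∀ i, X i → ENNReal) (hf : ∀ i, Measurable (f i))
    [∀ i, IsProbabilityMeasure ((q i).withDensity (f i))] :
    (Measure.pi q).withDensity (fun x => ∏ i, f i (x i)) =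
      Measure.pi fun i => (q i).withDensity (f i) := by
  symm
  apply Measure.pi_eq
  intro s hs
  rw [withDensity_apply _ (MeasurableSet.univ_pi hs), ← lintegral_indicator
    (MeasurableSet.univ_pi hs)]
  have h1 : ∀ x : ∀ i, X i, (Set.univ.pi s).indicator (fun x => ∏ i, f i (x i)) x =
      ∏ i, (s i).indicator (f i) (x i) := by
    intro x
    by_cases hx : x ∈ Set.univ.pi s
    · rw [Set.indicator_of_mem hx]
      exact Finset.prod_congr rfl fun i _ => (Set.indicator_of_mem (hx i trivial) _).symm
    · rw [Set.indicator_of_notMem hx]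
      simp only [Set.mem_univ_pi, not_forall] at hx
      obtain ⟨i, hi⟩ := hx
      exact (Finset.prod_eq_zero (Finset.mem_univ i) (Set.indicator_of_notMem hi _)).symm
  simp_rw [h1]
  have hind := iIndepFun_pi (μ := q) (X := fun i => (s i).indicator (f i))
    (fun i => ((hf i).indicator (hs i)).aemeasurable)
  have := lintegral_prod_eq_prod_lintegral_of_indepFun Finset.univ
    (fun i (x : ∀ i, X i) => (s i).indicator (f i) (x i)) hind
    (fun i => ((hf i).indicator (hs i)).comp (measurable_pi_apply i))
  rw [this]
  refine Finset.prod_congr rfl fun i _ => ?_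
  rw [withDensity_apply _ (hs i), ← lintegral_indicator (hs i)]
  exact (measurePreserving_eval q i).lintegral_comp ((hf i).indicator (hs i))

/-- The Gaussian shift density between two product Gaussians of the same variance. -/
theorem pi_gaussianReal_withDensity {ι : Type*} [Fintype ι] (m m' : ι → ℝ) {v : NNReal}
    (hv : v ≠ 0) :
    (Measure.pi fun i => gaussianReal (m' i) v).withDensity
      (fun x => ENNReal.ofReal (Real.exp
        (∑ i, (m i - m' i) / v * x i - ∑ i, (m i ^ 2 - m' i ^ 2) / (2 * v)))) =
      Measure.pi fun i => gaussianReal (m i) v := by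
  have hw := fun i => gaussianReal_withDensity_gaussianReal (m i) (m' i) hv
  have : ∀ i, IsProbabilityMeasure ((gaussianReal (m' i) v).withDensity
      (fun x => ENNReal.ofReal
        (Real.exp ((m i - m' i) / v * x - (m i ^ 2 - m' i ^ 2) / (2 * v))))) := fun i => by
    rw [hw i]; infer_instance
  have h := pi_withDensity (fun i => gaussianReal (m' i) v) (fun i x => ENNReal.ofReal
        (Real.exp ((m i - m' i) / v * x - (m i ^ 2 - m' i ^ 2) / (2 * v))))
        (fun i => by fun_prop)
  simp_rw [hw] at h
  rw [← h]
  congr 1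
  ext x
  rw [← Finset.sum_sub_distrib, Real.exp_sum,
    ENNReal.ofReal_prod_of_nonneg fun _ _ => (Real.exp_pos _).le]

/-- Change of measure: an event has probability at most `exp s` times its reference probability,
plus the probability that the log-likelihood ratio exceeds `s`. -/
theorem pi_gaussianReal_change_of_measure {ι : Type*} [Fintype ι] (m m' : ι → ℝ) {v : NNReal}
    (hv : v ≠ 0) {A : Set (ι → ℝ)} (hA : MeasurableSet A) (s D : ℝ)
    (hD : D = (∑ i, (m i - m' i) ^ 2) / v) :
    (Measure.pi fun i => gaussianReal (m i) v).real A ≤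
      Real.exp s * (Measure.pi fun i => gaussianReal (m' i) v).real A +
        (gaussianReal (D / 2) (Real.toNNReal D)).real (Set.Ioi s) := by
  set p := Measure.pi fun i => gaussianReal (m i) v with hp
  set q := Measure.pi fun i => gaussianReal (m' i) v with hq
  set c := ∑ i, (m i ^ 2 - m' i ^ 2) / (2 * (v : ℝ)) with hc
  set L : (ι → ℝ) → ℝ := fun x => ∑ i, (m i - m' i) / v * x i - c with hL
  have hv' : (v : ℝ) ≠ 0 := by exact_mod_cast hv
  have hLm : Measurable L := by fun_prop
  have hS : MeasurableSet {x | s < L x} := measurableSet_lt measurable_const hLm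
  have h1 : p.real (A \ {x | s < L x}) ≤ Real.exp s * q.real A := by
    have hle : p (A \ {x | s < L x}) ≤ ENNReal.ofReal (Real.exp s) * q A := by
      rw [hp, ← pi_gaussianReal_withDensity m m' hv, withDensity_apply _ (hA.diff hS)]
      calc _ ≤ ∫⁻ x in A \ {x | s < L x}, ENNReal.ofReal (Real.exp s) ∂q := by
            refine setLIntegral_mono measurable_const fun x hx => ?_
            have : L x ≤ s := not_lt.mp hx.2
            exact ENNReal.ofReal_le_ofReal (Real.exp_le_exp.mpr this)
        _ ≤ _ := by
            rw [setLIntegral_const]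
            gcongr
            exact Set.sdiff_subset
    have := ENNReal.toReal_mono (by finiteness) hle
    rwa [ENNReal.toReal_mul, ENNReal.toReal_ofReal (Real.exp_pos s).le] at this
  have h2 : p.real {x | s < L x} = (gaussianReal (D / 2) (Real.toNNReal D)).real (Set.Ioi s) := by
    -- Under `p` the log-likelihood ratio has mean half its variance, and the variance `D` is the
    -- squared distance of the means over `v`.
    have hmap : p.map L = gaussianReal (D / 2) (Real.toNNReal D) := by
      have : L = (fun y => y - c) ∘ (fun x => ∑ i, (m i - m' i) / v * x i) := rfl
      rw [this, ← Measure.map_map (by fun_prop) (by fun_prop), map_linear_pi_gaussianReal,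
        gaussianReal_map_sub_const]
      congr 1
      · rw [hD, hc, ← Finset.sum_sub_distrib, Finset.sum_div, Finset.sum_div]
        refine Finset.sum_congr rfl fun i _ => ?_
        field_simp
        ring
      · rw [← NNReal.coe_inj, NNReal.coe_mul, Real.coe_toNNReal, Real.coe_toNNReal, hD,
          Finset.mul_sum, Finset.sum_div]
        · refine Finset.sum_congr rfl fun i _ => ?_
          field_simp
        · rw [hD]; exact div_nonneg (Finset.sum_nonneg fun i _ => sq_nonneg _) v.2
        · exact Finset.sum_nonneg fun i _ => sq_nonneg _
    rw [← hmap, map_measureReal_apply hLm measurableSet_Ioi]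
    rfl
  calc p.real A ≤ p.real ((A \ {x | s < L x}) ∪ {x | s < L x}) :=
        measureReal_mono (by rw [Set.sdiff_union_self]; exact Set.subset_union_left)
    _ ≤ p.real (A \ {x | s < L x}) + p.real {x | s < L x} := measureReal_union_le _ _
    _ ≤ _ := by rw [h2]; gcongr

theorem gaussianReal_eq_map_std (m D : ℝ) (hD : 0 ≤ D) :
    gaussianReal m (Real.toNNReal D) = (gaussianReal 0 1).map (fun z => √D * z + m) := by
  have : (fun z => √D * z + m) = (fun y => y + m) ∘ (fun z => √D * z) := rfl
  rw [this, ← Measure.map_map (by fun_prop) (by fun_prop), gaussianReal_map_const_mul,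
    gaussianReal_map_add_const]
  congr 1
  · simp
  · rw [← NNReal.coe_inj]; simp [Real.sq_sqrt hD, Real.coe_toNNReal _ hD]

/-- Standardising, `s` is at least one standard deviation below the mean, or closer. Degenerate `D =
0` is included: the law is then a point mass at `m ≤ s`. -/
theorem gaussianReal_Ioi_le_std {m D s : ℝ} (hD : 0 ≤ D) (hs : m - √D ≤ s) :
    (gaussianReal m (Real.toNNReal D)).real (Set.Ioi s) ≤
      (gaussianReal 0 1).real (Set.Ioi (-1)) := by
  rw [gaussianReal_eq_map_std m D hD, map_measureReal_apply (by fun_prop) measurableSet_Ioi]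
  refine measureReal_mono fun z hz => ?_
  simp only [Set.mem_preimage, Set.mem_Ioi] at hz ⊢
  have h0 := Real.sqrt_nonneg D
  by_contra hcon
  nlinarith

theorem gaussianReal_std_Ioi_lt_one : (gaussianReal 0 1).real (Set.Ioi (-1)) < 1 := by
  have hne : gaussianReal 0 1 (Set.Iic (-1)) ≠ 0 := by
    intro h
    have := (gaussianReal_absolutelyContinuous' 0 one_ne_zero) h
    simp at this
  have h1 := measureReal_add_measureReal_compl (μ := gaussianReal 0 1)
    (measurableSet_Iic (a := (-1 : ℝ)))
  rw [Set.compl_Iic, probReal_univ] at h1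
  have h2 : 0 < (gaussianReal 0 1).real (Set.Iic (-1)) :=
    ENNReal.toReal_pos hne (measure_ne_top _ _)
  linarith

/-- Mills ratio bound for the lower tail. -/
theorem gaussianReal_std_Iic_le {x : ℝ} (hx : 0 < x) :
    (gaussianReal 0 1).real (Set.Iic (-x)) ≤ Real.exp (-(x ^ 2 / 2)) / x := by
  have h0 : (gaussianReal 0 1).real (Set.Iic (-x)) =
      ∫ y in Set.Iic (-x), gaussianPDFReal 0 1 y := by
    rw [measureReal_def, gaussianReal_apply_eq_integral _ one_ne_zero, ENNReal.toReal_ofReal]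
    exact integral_nonneg fun y => gaussianPDFReal_nonneg _ _ _
  have hint : IntegrableOn (fun y => Real.exp (x ^ 2 / 2) * Real.exp (x * y)) (Set.Iic (-x)) :=
    (integrableOn_exp_mul_Iic hx _).const_mul _
  rw [h0]
  -- Since `(x + y)² ≥ 0`, the density is dominated by an exponential with an explicit integral,
  -- tangent to the Gaussian exponent at `y = -x`.
  calc _ ≤ ∫ y in Set.Iic (-x), Real.exp (x ^ 2 / 2) * Real.exp (x * y) := by
        refine setIntegral_mono_on (integrable_gaussianPDFReal 0 1).integrableOn hint
          measurableSet_Iic fun y _ => ?_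
        rw [gaussianPDFReal_def, ← Real.exp_add]
        have h1 : (√(2 * Real.pi * ((1 : NNReal) : ℝ)))⁻¹ ≤ 1 := by
          apply inv_le_one_of_one_le₀
          rw [Real.one_le_sqrt]
          have := Real.pi_gt_three
          push_cast; linarith
        calc _ ≤ 1 * Real.exp (-(y - 0) ^ 2 / (2 * ((1 : NNReal) : ℝ))) :=
              mul_le_mul_of_nonneg_right h1 (Real.exp_pos _).le
          _ ≤ _ := by
            rw [one_mul]
            apply Real.exp_le_exp.mpr
            push_cast
            nlinarith [sq_nonneg (x + y)]
    _ = _ := by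
        rw [integral_const_mul, integral_exp_mul_Iic hx, mul_div_assoc', ← Real.exp_add]
        congr 2
        ring

/-! ### Distances between mean vectors -/

theorem card_hyperedge_subset {N h : ℕ} (S : Finset (Fin N)) :
    (Finset.univ.filter fun e : Hyperedge N h => e.1 ⊆ S).card = S.card.choose h := by
  rw [← Finset.card_powersetCard, ← Finset.card_map (Function.Embedding.subtype _)]
  congr 1
  ext e
  simp [Finset.mem_powersetCard, and_comm]

theorem sum_hyperedge_ite {N h : ℕ} (S : Finset (Fin N)) (c : ℝ) :
    (∑ e : Hyperedge N h, if e.1 ⊆ S then c else 0) = S.card.choose h * c := by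
  rw [← Finset.sum_filter, Finset.sum_const, card_hyperedge_subset, nsmul_eq_mul]

/-- The means differ exactly on the hyperedges of `S` through the one vertex outside `R`; Pascal's
rule counts them. -/
theorem sum_sq_mean_sub_of_superset {N h k : ℕ} (hh : 1 ≤ h) (hk : 1 ≤ k) (μ : ℝ)
    {R S : Finset (Fin N)} (hRS : R ⊆ S) (hR : R.card = k - 1) (hS : S.card = k) :
    (∑ e : Hyperedge N h, ((if e.1 ⊆ S then μ else 0) - (if e.1 ⊆ R then μ else 0)) ^ 2) =
      (k - 1).choose (h - 1) * μ ^ 2 := by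
  have h1 : ∀ e : Hyperedge N h,
      ((if e.1 ⊆ S then μ else 0) - (if e.1 ⊆ R then μ else 0)) ^ 2 =
        (if e.1 ⊆ S then μ ^ 2 else 0) - (if e.1 ⊆ R then μ ^ 2 else 0) := by
    intro e
    by_cases he : e.1 ⊆ R
    · simp [he, he.trans hRS]
    · by_cases he' : e.1 ⊆ S <;> simp [he, he']
  simp_rw [h1]
  rw [Finset.sum_sub_distrib, sum_hyperedge_ite, sum_hyperedge_ite, hR, hS]
  obtain ⟨k, rfl⟩ := Nat.exists_eq_add_of_le' hk
  obtain ⟨h, rfl⟩ := Nat.exists_eq_add_of_le' hh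
  rw [Nat.choose_succ_succ]
  push_cast
  simp
  ring

/-- The factor `1 - h/(k+1)` is the fraction of `k`-subsets of `T` containing a given hyperedge of
`T`, so the reference is the average of the planted means. Planting the full `μ` on `T` would cost
`C(k, h-1) μ²`, which is too much in general. -/
theorem sum_sq_mean_sub_of_subset {N h k : ℕ} (hh : 1 ≤ h) (hk : 1 ≤ k) (μ : ℝ)
    {S T : Finset (Fin N)} (hST : S ⊆ T) (hS : S.card = k) (hT : T.card = k + 1) :
    (∑ e : Hyperedge N h, ((if e.1 ⊆ S then μ else 0) -
        (if e.1 ⊆ T then (1 - h / (k + 1) : ℝ) * μ else 0)) ^ 2) ≤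
      (k - 1).choose (h - 1) * μ ^ 2 := by
  set c : ℝ := 1 - h / (k + 1) with hc
  have h1 : ∀ e : Hyperedge N h,
      ((if e.1 ⊆ S then μ else 0) - (if e.1 ⊆ T then c * μ else 0)) ^ 2 =
        (if e.1 ⊆ S then ((1 - c) ^ 2 - c ^ 2) * μ ^ 2 else 0)
          + (if e.1 ⊆ T then c ^ 2 * μ ^ 2 else 0) := by
    intro e
    by_cases he : e.1 ⊆ S
    · simp [he, he.trans hST]; ring
    · by_cases he' : e.1 ⊆ T <;> simp [he, he']
      ring
  simp_rw [h1]
  rw [Finset.sum_add_distrib, sum_hyperedge_ite, sum_hyperedge_ite, hS, hT]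
  obtain ⟨k, rfl⟩ := Nat.exists_eq_add_of_le' hk
  obtain ⟨h, rfl⟩ := Nat.exists_eq_add_of_le' hh
  have e1 : ((k + 1 : ℕ) : ℝ) * k.choose h = (k + 1).choose (h + 1) * (h + 1 : ℕ) := by
    exact_mod_cast Nat.add_one_mul_choose_eq k h
  have e2 : ((k + 1 + 1 : ℕ) : ℝ) * (k + 1).choose h =
      (k + 1 + 1).choose (h + 1) * (h + 1 : ℕ) := by
    exact_mod_cast Nat.add_one_mul_choose_eq (k + 1) h
  have e3 : (((k + 1 + 1).choose (h + 1) : ℕ) : ℝ) =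
      (k + 1).choose h + (k + 1).choose (h + 1) := by
    exact_mod_cast Nat.choose_succ_succ (k + 1) h
  simp only [Nat.add_sub_cancel]
  rw [← sub_nonneg]
  have hk0 : (0 : ℝ) < k + 1 + 1 := by positivity
  set d : ℝ := ((k.choose h : ℕ) : ℝ)
  set x : ℝ := (((k + 1).choose (h + 1) : ℕ) : ℝ)
  set y : ℝ := (((k + 1).choose h : ℕ) : ℝ)
  set z : ℝ := (((k + 1 + 1).choose (h + 1) : ℕ) : ℝ)
  push_cast at *
  have hd : 0 ≤ d := by positivity
  have e4 : y * (k + 1 + 1 - (h + 1)) = x * (h + 1) := by rw [e3] at e2; linarith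
  -- The bound holds with an exact surplus. Here `k` and `h` have been shifted by one, so `k + 1 +
  -- 1` is the size of `T`.
  have key : d * μ ^ 2 - (x * (((1 - c) ^ 2 - c ^ 2) * μ ^ 2) + z * (c ^ 2 * μ ^ 2)) =
      d * μ ^ 2 / (k + 1 + 1) := by
    have hc1 : c * (k + 1 + 1) = k + 1 + 1 - (h + 1) := by rw [hc]; field_simp
    have h2 : y * c * (k + 1 + 1) = (k + 1) * d := by
      rw [mul_assoc, hc1, e4, e1]
    have h3 : x * (1 - c) * (k + 1 + 1) = (k + 1) * d := by
      rw [e1]; linear_combination (-x) * hc1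
    have h4 : (x * ((1 - c) ^ 2 - c ^ 2) + z * c ^ 2) * (k + 1 + 1) = (k + 1) * d := by
      rw [e3]; linear_combination (1 - c) * h3 + c * h2
    rw [eq_div_iff hk0.ne']
    linear_combination (- μ ^ 2) * h4
  rw [key]
  positivity

/-! ### Counting vertex sets by inclusion and by overlap -/

theorem card_filter_superset {N k : ℕ} {S : Finset (Fin N)} (hS : S.card = k) :
    (((Finset.univ : Finset (Fin N)).powersetCard (k + 1)).filter fun T => S ⊆ T).card =
      N - k := by
  have : (((Finset.univ : Finset (Fin N)).powersetCard (k + 1)).filter fun T => S ⊆ T) =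
      Sᶜ.image fun i => insert i S := by
    ext T
    simp only [Finset.mem_filter, Finset.mem_powersetCard, Finset.subset_univ, true_and,
      Finset.mem_image, Finset.mem_compl]
    constructor
    · rintro ⟨hT, hST⟩
      obtain ⟨i, hi, rfl⟩ :=
        Finset.covBy_iff_exists_insert.mp (Finset.covBy_iff_card_sdiff_eq_one.mpr
          ⟨hST, by rw [Finset.card_sdiff_of_subset hST]; omega⟩)
      exact ⟨i, hi, rfl⟩
    · rintro ⟨i, hi, rfl⟩
      exact ⟨by rw [Finset.card_insert_of_notMem hi, hS], Finset.subset_insert _ _⟩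
  rw [this, Finset.card_image_of_injOn, Finset.card_compl, hS, Fintype.card_fin]
  intro i hi j hj hij
  have hi' : i ∉ S := by simpa using hi
  have : i ∈ insert j S := by
    have h0 : i ∈ insert i S := Finset.mem_insert_self _ _
    exact (show insert i S = insert j S from hij) ▸ h0
  simpa [hi'] using this

/-- Double counting of pairs of a `k`-set and a `k - 1`-subset. -/
theorem sum_powersetCard_superset {N k : ℕ} (hk : 1 ≤ k) (f : Finset (Fin N) → ℝ) :
    (∑ R ∈ (Finset.univ : Finset (Fin N)).powersetCard (k - 1),
      ∑ S ∈ (Finset.univ.powersetCard k).filter (R ⊆ ·), f S) =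
      k * ∑ S ∈ (Finset.univ : Finset (Fin N)).powersetCard k, f S := by
  rw [Finset.sum_comm' (t' := Finset.univ.powersetCard k) (s' := fun S => S.powersetCard (k - 1))
    (by intro R S; simp only [Finset.mem_filter, Finset.mem_powersetCard, Finset.subset_univ,
          true_and]; tauto), Finset.mul_sum]
  refine Finset.sum_congr rfl fun S hS => ?_
  rw [Finset.sum_const, Finset.card_powersetCard, (Finset.mem_powersetCard.mp hS).2, nsmul_eq_mul]
  congr
  obtain ⟨k, rfl⟩ := Nat.exists_eq_add_of_le' hk
  simp

/-- Double counting of pairs of a `k`-set and a `k + 1`-superset. -/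
theorem sum_powersetCard_subset {N k : ℕ} (hk : k ≤ N) (f : Finset (Fin N) → ℝ) :
    (∑ T ∈ (Finset.univ : Finset (Fin N)).powersetCard (k + 1), ∑ S ∈ T.powersetCard k, f S) =
      (N - k) * ∑ S ∈ (Finset.univ : Finset (Fin N)).powersetCard k, f S := by
  rw [Finset.sum_comm' (t' := Finset.univ.powersetCard k)
    (s' := fun S => (Finset.univ.powersetCard (k + 1)).filter (S ⊆ ·))
    (by intro R S; simp only [Finset.mem_filter, Finset.mem_powersetCard, Finset.subset_univ,
          true_and]; tauto), Finset.mul_sum]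
  refine Finset.sum_congr rfl fun S hS => ?_
  rw [Finset.sum_const, card_filter_superset (Finset.mem_powersetCard.mp hS).2, nsmul_eq_mul,
    Nat.cast_sub hk]

/-- The number of `k`-sets meeting a given `k`-set in exactly `j` elements. -/
theorem card_filter_inter_card_le {N k : ℕ} {S : Finset (Fin N)} (hS : S.card = k) (j : ℕ) :
    ((Finset.univ.powersetCard k).filter fun S' => (S ∩ S').card = j).card ≤
      k.choose (k - j) * (N - k).choose (k - j) := by
  have h1 : k.choose (k - j) * (N - k).choose (k - j) =
      (S.powersetCard (k - j) ×ˢ Sᶜ.powersetCard (k - j)).card := by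
    rw [Finset.card_product, Finset.card_powersetCard, Finset.card_powersetCard, hS,
      Finset.card_compl, hS, Fintype.card_fin]
  rw [h1]
  -- With `S` fixed, `S'` is determined by what it loses and what it gains.
  refine Finset.card_le_card_of_injOn (fun S' => (S \ S', S' \ S)) ?_ ?_
  · intro S' hS'
    simp only [Finset.coe_filter, Finset.mem_powersetCard, Finset.subset_univ, true_and,
      Set.mem_ofPred_eq] at hS'
    simp only [Finset.coe_product, Set.mem_prod, Finset.mem_coe, Finset.mem_powersetCard]
    refine ⟨⟨Finset.sdiff_subset, ?_⟩, fun i hi => ?_, ?_⟩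
    · rw [Finset.card_sdiff, Finset.inter_comm, hS'.2, hS]
    · exact Finset.mem_compl.mpr (Finset.mem_sdiff.mp hi).2
    · rw [Finset.card_sdiff, hS'.2, hS'.1]
  · intro S₁ _ S₂ _ h12
    simp only [Prod.mk.injEq] at h12
    ext i
    have ha := congrArg (i ∈ ·) h12.1
    have hb := congrArg (i ∈ ·) h12.2
    simp only [Finset.mem_sdiff, eq_iff_iff] at ha hb
    tauto

theorem sum_inter_card_le {N k : ℕ} {S : Finset (Fin N)} (hS : S.card = k) (g : ℕ → ℝ)
    (hg : ∀ j, 0 ≤ g j) :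
    (∑ S' ∈ (Finset.univ.powersetCard k).filter (· ≠ S), g (S ∩ S').card) ≤
      ∑ j ∈ Finset.range k, (k.choose (k - j) * (N - k).choose (k - j) : ℝ) * g j := by
  rw [← Finset.sum_fiberwise_of_maps_to (t := Finset.range k) (g := fun S' => (S ∩ S').card)]
  · refine Finset.sum_le_sum fun j _ => ?_
    rw [Finset.sum_congr rfl (g := fun _ => g j)
      (fun S' hS' => by rw [(Finset.mem_filter.mp hS').2]), Finset.sum_const, nsmul_eq_mul]
    refine mul_le_mul_of_nonneg_right ?_ (hg j)
    have h1 := card_filter_inter_card_le hS j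
    have h2 := Finset.card_le_card (Finset.filter_subset_filter (fun S' => (S ∩ S').card = j)
      (Finset.filter_subset (· ≠ S) (Finset.univ.powersetCard k)))
    exact_mod_cast h2.trans h1
  · intro S' hS'
    simp only [Finset.mem_filter, Finset.mem_powersetCard, Finset.subset_univ, true_and] at hS'
    rw [Finset.mem_range]
    by_contra hcon
    have h1 : S ∩ S' = S := Finset.eq_of_subset_of_card_le Finset.inter_subset_left (by omega)
    have h2 : S ⊆ S' := Finset.inter_eq_left.mp h1
    exact hS'.2 (Finset.eq_of_subset_of_card_le h2 (by omega)).symm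

/-! ### Binomial inequalities for the signal gap -/

/-- Convexity alone would give the ratio `j/k`. The sharper `(j-1)/k` is what yields the extra `+1`
in `le_mul_choose_sub_choose`, hence a spare factor `1/N` in regime (i). -/
theorem mul_choose_le_sub_one_mul_choose {j k h : ℕ} (hj : 1 ≤ j) (hjk : j < k) (hh : 2 ≤ h) :
    k * j.choose h ≤ (j - 1) * k.choose h := by
  obtain ⟨k, rfl⟩ := Nat.exists_eq_add_of_le' (show 1 ≤ k by omega)
  obtain ⟨j, rfl⟩ := Nat.exists_eq_add_of_le' hj
  obtain ⟨h, rfl⟩ := Nat.exists_eq_add_of_le' (show 1 ≤ h by omega)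
  have e1 := Nat.add_one_mul_choose_eq k h
  have e2 := Nat.add_one_mul_choose_eq j h
  have e3 := Nat.choose_mul_succ_eq j h
  have h4 : (j + 1) * j.choose h ≤ j * k.choose h := by
    calc (j + 1) * j.choose h = (j + 1).choose h * (j + 1 - h) := by rw [← e3, mul_comm]
      _ ≤ k.choose h * j := Nat.mul_le_mul (Nat.choose_le_choose h (by omega)) (by omega)
      _ = _ := mul_comm _ _
  refine Nat.le_of_mul_le_mul_right (c := h + 1) ?_ (by omega)
  calc (k + 1) * (j + 1).choose (h + 1) * (h + 1) = (k + 1) * ((j + 1) * j.choose h) := by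
        rw [e2, mul_assoc]
    _ ≤ (k + 1) * (j * k.choose h) := Nat.mul_le_mul_left _ h4
    _ = (j + 1 - 1) * ((k + 1) * k.choose h) := by rw [Nat.add_sub_cancel]; ring
    _ = _ := by rw [e1]; ring

theorem choose_pred_mul {k h : ℕ} (hh : 1 ≤ h) (hk : 1 ≤ k) :
    (k : ℝ) * (k - 1).choose (h - 1) = h * k.choose h := by
  obtain ⟨k, rfl⟩ := Nat.exists_eq_add_of_le' hk
  obtain ⟨h, rfl⟩ := Nat.exists_eq_add_of_le' hh
  rw [mul_comm ((h + 1 : ℕ) : ℝ)]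
  exact_mod_cast Nat.add_one_mul_choose_eq k h

theorem le_mul_choose_sub_choose {j k h : ℕ} (hj : 1 ≤ j) (hjk : j < k) (hh : 2 ≤ h) :
    ((k : ℝ) - j + 1) * (k - 1).choose (h - 1) ≤ h * ((k.choose h : ℝ) - j.choose h) := by
  have h1 : (k : ℝ) * j.choose h ≤ (j - 1) * k.choose h := by
    have := mul_choose_le_sub_one_mul_choose hj hjk hh
    have h2 : ((j - 1 : ℕ) : ℝ) = j - 1 := by push_cast [hj]; rfl
    rw [← h2]
    exact_mod_cast this
  have h2 := choose_pred_mul (k := k) (h := h) (by omega) (by omega)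
  have hk : (0 : ℝ) < k := by exact_mod_cast (by omega : 0 < k)
  refine le_of_mul_le_mul_left ?_ hk
  calc (k : ℝ) * (((k : ℝ) - j + 1) * (k - 1).choose (h - 1))
      = ((k : ℝ) - j + 1) * (h * k.choose h) := by rw [← h2]; ring
    _ = h * (k * k.choose h - (j - 1) * k.choose h) := by ring
    _ ≤ h * (k * k.choose h - k * j.choose h) := by gcongr
    _ = _ := by ring

theorem sub_mul_choose_le_mul_choose_sub_choose {j k h : ℕ} (hjk : j < k) (hh : 2 ≤ h) :
    ((k : ℝ) - j) * (k - 1).choose (h - 1) ≤ h * ((k.choose h : ℝ) - j.choose h) := by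
  rcases Nat.eq_zero_or_pos j with rfl | hj
  · have h2 := choose_pred_mul (k := k) (h := h) (by omega) (by omega)
    rw [Nat.choose_eq_zero_of_lt (show 0 < h by omega)]
    simp only [Nat.cast_zero, sub_zero]
    exact h2.le
  · refine le_trans ?_ (le_mul_choose_sub_choose hj hjk hh)
    gcongr
    linarith

/-- Unimodality of the binomial row on `2 ≤ h ≤ k - 2`. It turns smallness of `d/h` into a
logarithmic bound on `k`. -/
theorem choose_two_le_choose {k h : ℕ} (hh : 2 ≤ h) (hk : h + 2 ≤ k) :
    k.choose 2 ≤ k.choose h := by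
  induction k generalizing h with
  | zero => omega
  | succ k ih =>
    rcases Nat.lt_or_ge k (h + 2) with hlt | hge
    · have : k + 1 = h + 2 := by omega
      rw [this, Nat.choose_symm_of_eq_add (add_comm h 2)]
    · rcases Nat.eq_or_lt_of_le hh with rfl | h3
      · rfl
      · obtain ⟨h, rfl⟩ := Nat.exists_eq_add_of_le' (show 1 ≤ h by omega)
        rw [Nat.choose_succ_succ, Nat.choose_succ_succ]
        refine Nat.add_le_add ?_ (ih hh hge)
        refine le_trans ?_ (ih (show 2 ≤ h by omega) (by omega))
        rw [Nat.choose_one_right, Nat.choose_two_right, Nat.le_div_iff_mul_le two_pos]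
        exact Nat.mul_le_mul_left _ (by omega)

/-! ### Impossibility below the lower threshold -/

instance isProbabilityMeasure_weightLaw (N h : ℕ) (μ σ : ℝ) (S : Finset (Fin N)) :
    IsProbabilityMeasure (weightLaw N h μ σ S) := by
  unfold weightLaw; infer_instance

/-- The success probability of an estimator is the average over the planted communities. -/
theorem hWSBM_real_eq {N k h : ℕ} (μ σ : ℝ) {Shat : (Hyperedge N h → ℝ) → Finset (Fin N)}
    (hS : Measurable Shat) :
    (hWSBM μ σ N k h).real {p | p.1 = Shat p.2} =
      (N.choose k : ℝ)⁻¹ * ∑ S ∈ (Finset.univ : Finset (Fin N)).powersetCard k,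
        (weightLaw N h μ σ S).real {E | Shat E = S} := by
  have hmeas : MeasurableSet {p : Finset (Fin N) × (Hyperedge N h → ℝ) | p.1 = Shat p.2} :=
    measurableSet_eq_fun measurable_fst (hS.comp measurable_snd)
  rw [measureReal_def, hWSBM, Measure.smul_apply, Measure.finsetSum_apply, smul_eq_mul,
    ENNReal.toReal_mul, ENNReal.toReal_inv, ENNReal.toReal_natCast, ENNReal.toReal_sum]
  · congr 1
    refine Finset.sum_congr rfl fun S _ => ?_
    rw [Measure.dirac_prod, Measure.map_apply measurable_prodMk_left hmeas, measureReal_def]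
    congr 2
    ext E
    simp [eq_comm]
  · intro S _
    exact measure_ne_top _ _

/-- All communities of the family `F` are compared with one reference mean `m'`, so the factor `exp
s` is paid once for the whole family rather than once per member. -/
theorem sum_real_estimator_eq_le {N h : ℕ} {μ σ : ℝ}
    {Shat : (Hyperedge N h → ℝ) → Finset (Fin N)} (hS : Measurable Shat)
    (hσ : Real.toNNReal (σ ^ 2) ≠ 0) (F : Finset (Finset (Fin N))) (m' : Hyperedge N h → ℝ)
    {s D₀ : ℝ}
    (hF : ∀ S ∈ F, (∑ e : Hyperedge N h, ((if e.1 ⊆ S then μ else 0) - m' e) ^ 2) ≤ D₀ * σ ^ 2)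
    (hs : ∀ D, 0 ≤ D → D ≤ D₀ → D / 2 - √D ≤ s) :
    ∑ S ∈ F, (weightLaw N h μ σ S).real {E | Shat E = S} ≤
      Real.exp s + F.card * (gaussianReal 0 1).real (Set.Ioi (-1)) := by
  set q := Measure.pi fun e => gaussianReal (m' e) (Real.toNNReal (σ ^ 2)) with hq
  have hmeas : ∀ S, MeasurableSet {E | Shat E = S} := fun S => hS (measurableSet_singleton S)
  have hσ' : 0 < σ ^ 2 := by
    by_contra hcon
    exact hσ (Real.toNNReal_of_nonpos (not_lt.mp hcon))
  have h1 : ∀ S ∈ F, (weightLaw N h μ σ S).real {E | Shat E = S} ≤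
      Real.exp s * q.real {E | Shat E = S} + (gaussianReal 0 1).real (Set.Ioi (-1)) := by
    intro S hSF
    refine (pi_gaussianReal_change_of_measure _ m' hσ (hmeas S) s _ rfl).trans ?_
    have h0 : 0 ≤ ∑ e : Hyperedge N h, ((if e.1 ⊆ S then μ else 0) - m' e) ^ 2 :=
      Finset.sum_nonneg fun e _ => sq_nonneg _
    rw [Real.coe_toNNReal _ hσ'.le]
    have hD0 := div_nonneg h0 hσ'.le
    gcongr
    exact gaussianReal_Ioi_le_std hD0 (hs _ hD0 ((div_le_iff₀ hσ').mpr (hF S hSF)))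
  refine (Finset.sum_le_sum h1).trans ?_
  rw [Finset.sum_add_distrib, ← Finset.mul_sum, Finset.sum_const, nsmul_eq_mul]
  -- An estimator outputs one set, so these events are disjoint under the common law `q`.
  have h2 : ∑ S ∈ F, q.real {E | Shat E = S} ≤ 1 := by
    rw [← measureReal_biUnion_finset (fun S _ S' _ hne => ?_) (fun S _ => hmeas S)]
    · exact measureReal_le_one
    · exact Set.disjoint_left.mpr fun E hE hE' => hne (hE.symm.trans hE')
  have := mul_le_mul_of_nonneg_left h2 (Real.exp_pos s).le
  linarith

/-- Upper bound on the success probability of any estimator in terms of the signal-to-noise ratio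
carried by a vertex of the community. -/
theorem hWSBM_real_le {N k h : ℕ} (hh : 1 ≤ h) (hhk : h ≤ k) (hkN : k < N) {μ σ : ℝ}
    {Shat : (Hyperedge N h → ℝ) → Finset (Fin N)} (hS : Measurable Shat)
    (hσ : Real.toNNReal (σ ^ 2) ≠ 0) {s D₀ : ℝ}
    (hD₀ : (k - 1).choose (h - 1) * μ ^ 2 ≤ D₀ * σ ^ 2)
    (hs : ∀ D, 0 ≤ D → D ≤ D₀ → D / 2 - √D ≤ s) :
    (hWSBM μ σ N k h).real {p | p.1 = Shat p.2} ≤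
      2 * Real.exp s / N + (gaussianReal 0 1).real (Set.Ioi (-1)) := by
  rw [hWSBM_real_eq μ σ hS]
  set c₀ := (gaussianReal 0 1).real (Set.Ioi (-1))
  set f : Finset (Fin N) → ℝ := fun S => (weightLaw N h μ σ S).real {E | Shat E = S}
  have hk : 1 ≤ k := hh.trans hhk
  have hcard : ((Finset.univ : Finset (Fin N)).powersetCard k).card = N.choose k := by
    rw [Finset.card_powersetCard, Finset.card_univ, Fintype.card_fin]
  have hC : (0 : ℝ) < N.choose k := by exact_mod_cast Nat.choose_pos hkN.le
  have hN : (0 : ℝ) < N := by exact_mod_cast (by omega : 0 < N)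
  have hkN' : (k : ℝ) < N := by exact_mod_cast hkN
  have he := Real.exp_pos s
  -- `M` is the size of each family; the case split makes it at least `N/2`.
  suffices H : ∃ M : ℝ, (N : ℝ) ≤ 2 * M ∧ M * ∑ S ∈ Finset.univ.powersetCard k, f S ≤
      N.choose k * (Real.exp s + M * c₀) by
    obtain ⟨M, hM, hle⟩ := H
    have hM0 : 0 < M := by linarith
    rw [inv_mul_le_iff₀ hC]
    have h1 : Real.exp s ≤ M * (2 * Real.exp s / N) := by
      rw [mul_div_assoc', le_div_iff₀ hN]
      nlinarith
    refine le_of_mul_le_mul_left (hle.trans ?_) hM0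
    calc _ ≤ N.choose k * (M * (2 * Real.exp s / N) + M * c₀) := by gcongr
      _ = _ := by ring
  rcases le_total (2 * k) N with h2k | h2k
  -- The number of `k`-sets containing a given `(k-1)`-set.
  · refine ⟨N - (k - 1), ?_, ?_⟩
    · have : (2 * k : ℝ) ≤ N := by exact_mod_cast h2k
      linarith
    have hk0 : (0 : ℝ) < k := by exact_mod_cast hk
    have hsum : k * ∑ S ∈ Finset.univ.powersetCard k, f S ≤
        N.choose (k - 1) * Real.exp s + k * N.choose k * c₀ := by
      -- Double counting with the constant 1 gives the total size of all families.
      have hone := sum_powersetCard_superset (N := N) hk (fun _ => (1 : ℝ))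
      simp only [Finset.sum_const, nsmul_eq_mul, mul_one, hcard] at hone
      rw [← sum_powersetCard_superset hk, ← hone]
      calc _ ≤ ∑ R ∈ (Finset.univ : Finset (Fin N)).powersetCard (k - 1), (Real.exp s +
            ((Finset.univ.powersetCard k).filter (R ⊆ ·)).card * c₀) := by
            refine Finset.sum_le_sum fun R hR => ?_
            refine sum_real_estimator_eq_le hS hσ _ (fun e => if e.1 ⊆ R then μ else 0)
              (fun S hSF => ?_) hs
            simp only [Finset.mem_filter, Finset.mem_powersetCard, Finset.subset_univ,
              true_and] at hSF hR
            rw [sum_sq_mean_sub_of_superset hh hk μ hSF.2 hR hSF.1]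
            exact hD₀
        _ = _ := by
            rw [Finset.sum_add_distrib, Finset.sum_const, nsmul_eq_mul, Finset.sum_mul,
              Finset.card_powersetCard, Finset.card_univ, Fintype.card_fin]
    have hch : (N.choose (k - 1) : ℝ) * (N - (k - 1)) = k * N.choose k := by
      obtain ⟨k, rfl⟩ := Nat.exists_eq_add_of_le' hk
      have := Nat.choose_succ_right_eq N k
      have h3 : ((N - k : ℕ) : ℝ) = N - k := Nat.cast_sub (by omega)
      simp only [Nat.add_sub_cancel]
      push_cast
      rw [add_sub_cancel_right, ← h3, mul_comm ((k : ℝ) + 1)]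
      exact_mod_cast this.symm
    refine le_of_mul_le_mul_left ?_ hk0
    have hM0 : (0 : ℝ) ≤ N - (k - 1) := by linarith
    calc _ = (N - (k - 1) : ℝ) * (k * ∑ S ∈ Finset.univ.powersetCard k, f S) := by ring
      _ ≤ (N - (k - 1) : ℝ) * (N.choose (k - 1) * Real.exp s + k * N.choose k * c₀) := by gcongr
      _ = (N.choose (k - 1) * (N - (k - 1)) : ℝ) * Real.exp s +
          (N - (k - 1) : ℝ) * (k * N.choose k * c₀) := by ring
      _ = _ := by rw [hch]; ring
  -- The number of `k`-subsets of a given `(k+1)`-set.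
  · refine ⟨k + 1, ?_, ?_⟩
    · have : (N : ℝ) ≤ 2 * k := by exact_mod_cast h2k
      linarith
    have hNk : (0 : ℝ) < N - k := by linarith
    have hsum : (N - k) * ∑ S ∈ Finset.univ.powersetCard k, f S ≤
        N.choose (k + 1) * Real.exp s + (N - k) * N.choose k * c₀ := by
      have hone := sum_powersetCard_subset (N := N) hkN.le (fun _ => (1 : ℝ))
      simp only [Finset.sum_const, nsmul_eq_mul, mul_one, hcard] at hone
      rw [← sum_powersetCard_subset hkN.le, ← hone]
      calc _ ≤ ∑ T ∈ (Finset.univ : Finset (Fin N)).powersetCard (k + 1), (Real.exp s +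
            (T.powersetCard k).card * c₀) := by
            refine Finset.sum_le_sum fun T hT => ?_
            refine sum_real_estimator_eq_le hS hσ _
              (fun e => if e.1 ⊆ T then (1 - h / (k + 1) : ℝ) * μ else 0)
              (fun S hSF => ?_) hs
            simp only [Finset.mem_powersetCard, Finset.subset_univ, true_and] at hSF hT
            exact (sum_sq_mean_sub_of_subset hh hk μ hSF.1 hSF.2 hT).trans hD₀
        _ = _ := by
            rw [Finset.sum_add_distrib, Finset.sum_const, nsmul_eq_mul, Finset.sum_mul,
              Finset.card_powersetCard, Finset.card_univ, Fintype.card_fin]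
    have hch : (N.choose (k + 1) : ℝ) * (k + 1) = N.choose k * (N - k) := by
      have h3 : ((N - k : ℕ) : ℝ) = N - k := Nat.cast_sub hkN.le
      rw [← h3]
      exact_mod_cast Nat.choose_succ_right_eq N k
    refine le_of_mul_le_mul_left ?_ hNk
    calc _ = (k + 1 : ℝ) * ((N - k) * ∑ S ∈ Finset.univ.powersetCard k, f S) := by ring
      _ ≤ (k + 1 : ℝ) * (N.choose (k + 1) * Real.exp s + (N - k) * N.choose k * c₀) := by gcongr
      _ = (N.choose (k + 1) * (k + 1) : ℝ) * Real.exp s +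
          (k + 1 : ℝ) * ((N - k) * N.choose k * c₀) := by ring
      _ = _ := by rw [hch]; ring

theorem not_exactRecoverySolvable {μ σ : ℕ → ℝ} {k h : ℕ → ℕ}
    (hkh : ∀ᶠ N : ℕ in atTop, 1 ≤ h N ∧ h N ≤ k N ∧ k N < N)
    (hσ : ∀ᶠ N : ℕ in atTop, σ N ≠ 0)
    (hμ : ∀ᶠ N : ℕ in atTop,
      (k N - 1).choose (h N - 1) * μ N ^ 2 ≤ 2 * Real.log N * σ N ^ 2) :
    ¬ ExactRecoverySolvable μ σ k h := by
  rintro ⟨Shat, hmeas, hlim⟩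
  set c₀ := (gaussianReal 0 1).real (Set.Ioi (-1)) with hc₀
  have hc1 : c₀ < 1 := gaussianReal_std_Ioi_lt_one
  obtain ⟨C, hC0, hC⟩ : ∃ C : ℝ, 0 ≤ C ∧ 2 * Real.exp (-C) ≤ (1 - c₀) / 2 := by
    have h1 : Tendsto (fun C : ℝ => 2 * Real.exp (-C)) atTop (𝓝 (2 * 0)) :=
      (Real.tendsto_exp_atBot.comp tendsto_neg_atTop_atBot).const_mul 2
    have h2 := h1.eventually_le_const (u := (1 - c₀) / 2) (by linarith)
    obtain ⟨C, h3, h4⟩ := ((eventually_ge_atTop 0).and h2).exists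
    exact ⟨C, h3, h4⟩
  -- If `D/2 ≥ log N - C`, this forces `D ≥ C²`, so that one standard deviation `√D` absorbs `C`.
  have hlog : ∀ᶠ N : ℕ in atTop, C + C ^ 2 / 2 ≤ Real.log N :=
    (Real.tendsto_log_atTop.comp tendsto_natCast_atTop_atTop).eventually_ge_atTop _
  have hle : ∀ᶠ N : ℕ in atTop,
      (hWSBM (μ N) (σ N) N (k N) (h N)).real {p | p.1 = Shat N p.2} ≤ (1 - c₀) / 2 + c₀ := by
    filter_upwards [hkh, hσ, hμ, hlog] with N hN hσN hμN hlogN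
    have hN0 : (0 : ℝ) < N := by exact_mod_cast (by omega : 0 < N)
    have hv : Real.toNNReal (σ N ^ 2) ≠ 0 := by
      rw [Ne, Real.toNNReal_eq_zero, not_le]
      positivity
    refine (hWSBM_real_le hN.1 hN.2.1 hN.2.2 (hmeas N) hv (s := Real.log N - C) hμN ?_).trans ?_
    · intro D hD hD2
      rcases le_total (D / 2) (Real.log N - C) with h1 | h1
      · have := Real.sqrt_nonneg D
        linarith
      · have : C ≤ √D := Real.le_sqrt_of_sq_le (by nlinarith)
        linarith
    · rw [sub_eq_add_neg, Real.exp_add, Real.exp_log hN0]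
      have : 2 * (N * Real.exp (-C)) / N = 2 * Real.exp (-C) := by field_simp
      rw [this]
      linarith
  have := le_of_tendsto hlim hle
  linarith

/-! ### The inner-weight estimator and its union bound -/

/-- The total weight of the hyperedges inside a vertex set. -/
def innerWeight {N h : ℕ} (S : Finset (Fin N)) (E : Hyperedge N h → ℝ) : ℝ :=
  ∑ e : Hyperedge N h, (if e.1 ⊆ S then 1 else 0) * E e

theorem measurable_innerWeight {N h : ℕ} (S : Finset (Fin N)) :
    Measurable (innerWeight (h := h) S) := by
  unfold innerWeight; fun_prop

theorem sum_indicator_sub {N h : ℕ} (S S' : Finset (Fin N)) (c : ℝ) :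
    ∑ e : Hyperedge N h, ((if e.1 ⊆ S then (1 : ℝ) else 0) - (if e.1 ⊆ S' then 1 else 0)) *
      (if e.1 ⊆ S then c else 0) =
      ((S.card.choose h : ℝ) - (S ∩ S').card.choose h) * c := by
  rw [sub_mul, ← sum_hyperedge_ite, ← sum_hyperedge_ite, ← Finset.sum_sub_distrib]
  refine Finset.sum_congr rfl fun e _ => ?_
  by_cases h1 : e.1 ⊆ S <;> by_cases h2 : e.1 ⊆ S' <;> simp [h1, h2, Finset.subset_inter_iff]

theorem sum_indicator_sub_sq {N h k : ℕ} {S S' : Finset (Fin N)} (hS : S.card = k)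
    (hS' : S'.card = k) :
    ∑ e : Hyperedge N h, ((if e.1 ⊆ S then (1 : ℝ) else 0) - (if e.1 ⊆ S' then 1 else 0)) ^ 2 =
      2 * ((k.choose h : ℝ) - (S ∩ S').card.choose h) := by
  have h1 := sum_indicator_sub (h := h) S S' 1
  have h2 := sum_indicator_sub (h := h) S' S 1
  rw [hS, mul_one] at h1
  rw [hS', mul_one, Finset.inter_comm] at h2
  rw [two_mul]
  nth_rewrite 1 [← h1]
  rw [← h2, ← Finset.sum_add_distrib]
  refine Finset.sum_congr rfl fun e _ => ?_
  by_cases h1 : e.1 ⊆ S <;> by_cases h2 : e.1 ⊆ S' <;> simp [h1, h2]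

/-- The probability that a competitor `S'` has at least the inner weight of the planted
community `S`. -/
theorem weightLaw_real_innerWeight_le {N h k : ℕ} {S S' : Finset (Fin N)} (hS : S.card = k)
    (hS' : S'.card = k) {μ σ : ℝ} (hμ : 0 < μ) (hσ : 0 < σ) {y₀ y : ℝ} (hy₀ : 0 < y₀)
    (hy : y₀ ≤ y)
    (hn : y ≤ ((k.choose h : ℝ) - (S ∩ S').card.choose h) * (μ ^ 2 / (4 * σ ^ 2))) :
    (weightLaw N h μ σ S).real {E | innerWeight S E ≤ innerWeight S' E} ≤
      Real.exp (-y) / √(2 * y₀) := by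
  set n : ℝ := (k.choose h : ℝ) - (S ∩ S').card.choose h with hn_def
  have hn0 : 0 < n := by
    have h1 : 0 < n * (μ ^ 2 / (4 * σ ^ 2)) := by linarith
    exact pos_of_mul_pos_left h1 (by positivity)
  set a : Hyperedge N h → ℝ :=
    fun e => (if e.1 ⊆ S then (1 : ℝ) else 0) - (if e.1 ⊆ S' then 1 else 0) with ha
  have hset : {E : Hyperedge N h → ℝ | innerWeight S E ≤ innerWeight S' E} =
      (fun E => ∑ e, a e * E e) ⁻¹' Set.Iic 0 := by
    ext E
    simp only [Set.mem_ofPred_eq, Set.mem_preimage, Set.mem_Iic, innerWeight, ha, sub_mul,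
      Finset.sum_sub_distrib, sub_nonpos]
  have hD : 0 < 2 * n * σ ^ 2 := by positivity
  have hsD : 0 < √(2 * n * σ ^ 2) := Real.sqrt_pos.mpr hD
  -- Mean over standard deviation of the weight difference: the two sets have `n` private hyperedges
  -- each, and only those of `S` carry the mean `μ`.
  set x := n * μ / √(2 * n * σ ^ 2) with hx
  have hx2 : x ^ 2 / 2 = n * (μ ^ 2 / (4 * σ ^ 2)) := by
    rw [hx, div_pow, Real.sq_sqrt hD.le]
    field_simp
    ring
  have hx0 : 0 < x := by positivity
  have hlaw : (weightLaw N h μ σ S).real {E | innerWeight S E ≤ innerWeight S' E} =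
      (gaussianReal 0 1).real (Set.Iic (-x)) := by
    rw [hset, ← map_measureReal_apply (by fun_prop) measurableSet_Iic, weightLaw,
      map_linear_pi_gaussianReal, sum_indicator_sub, sum_indicator_sub_sq hS hS', hS, ← hn_def,
      ← Real.toNNReal_mul (by positivity),
      show σ ^ 2 * (2 * n) = 2 * n * σ ^ 2 by ring, gaussianReal_eq_map_std _ _ hD.le,
      map_measureReal_apply (by fun_prop) measurableSet_Iic]
    congr 1
    ext z
    simp only [Set.mem_preimage, Set.mem_Iic]
    rw [hx, ← neg_div, le_div_iff₀ hsD, mul_comm z]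
    constructor <;> intro h <;> linarith
  rw [hlaw]
  refine (gaussianReal_std_Iic_le hx0).trans ?_
  have h1 : √(2 * y₀) ≤ x := by
    rw [← Real.sqrt_sq hx0.le]
    exact Real.sqrt_le_sqrt (by linarith)
  have h2 : 0 < √(2 * y₀) := Real.sqrt_pos.mpr (by linarith)
  gcongr
  linarith

/-- There is a measurable estimator that returns the `k`-set of largest inner weight whenever it
is unique. -/
theorem exists_measurable_estimator (N k h : ℕ) :
    ∃ Shat : (Hyperedge N h → ℝ) → Finset (Fin N), Measurable Shat ∧
      ∀ S ∈ (Finset.univ : Finset (Fin N)).powersetCard k, ∀ E,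
        (∀ S' ∈ (Finset.univ.powersetCard k).filter (· ≠ S),
          innerWeight S' E < innerWeight S E) → Shat E = S := by
  classical
  set P : (Hyperedge N h → ℝ) → Finset (Fin N) → Prop := fun E S =>
    S ∈ (Finset.univ : Finset (Fin N)).powersetCard k ∧
      ∀ S' ∈ (Finset.univ.powersetCard k).filter (· ≠ S), innerWeight S' E < innerWeight S E
    with hP
  set pick : (Finset (Fin N) → Prop) → Finset (Fin N) :=
    fun p => if hp : ∃ S, p S then hp.choose else ∅ with hpick
  refine ⟨fun E => pick (P E), ?_, ?_⟩
  -- Factoring through the finite discrete space of predicates on vertex sets makes the choice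
  -- function measurable for free; only each comparison event has to be checked.
  · refine (Measurable.of_discrete (f := pick)).comp ?_
    refine measurable_pi_lambda _ fun S => ?_
    refine measurableSet_setOfPred.mp ?_
    refine MeasurableSet.inter (MeasurableSet.const _) ?_
    have : {E : Hyperedge N h → ℝ | ∀ S' ∈ (Finset.univ.powersetCard k).filter (· ≠ S),
        innerWeight S' E < innerWeight S E} =
        ⋂ S' ∈ (Finset.univ.powersetCard k).filter (· ≠ S),
          {E | innerWeight S' E < innerWeight S E} := by
      ext E; simp
    change MeasurableSet {E : Hyperedge N h → ℝ | _}
    rw [this]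
    exact Finset.measurableSet_biInter _ fun S' _ =>
      measurableSet_lt (measurable_innerWeight S') (measurable_innerWeight S)
  · intro S hS E hE
    have hex : ∃ S, P E S := ⟨S, hS, hE⟩
    have h1 : pick (P E) = hex.choose := dif_pos hex
    change pick (P E) = S
    rw [h1]
    by_contra hne
    have h2 := hex.choose_spec
    exact lt_asymm (hE _ (Finset.mem_filter.mpr ⟨h2.1, hne⟩))
      (h2.2 S (Finset.mem_filter.mpr ⟨hS, Ne.symm hne⟩))

/-- Union bound for the maximum likelihood estimator. -/
theorem exactRecoverySolvable_of_sum_le {μ σ : ℕ → ℝ} {k h : ℕ → ℕ} (B : ℝ)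
    (hkN : ∀ᶠ N : ℕ in atTop, k N ≤ N)
    (hμ : ∀ᶠ N : ℕ in atTop, 0 < μ N) (hσ : ∀ᶠ N : ℕ in atTop, 0 < σ N)
    (H : ∀ᶠ N : ℕ in atTop, ∃ a : ℕ → ℝ,
      (∀ j < k N, 1 ≤ a j ∧ a j * Real.log N ≤
        (((k N).choose (h N) : ℝ) - j.choose (h N)) * (μ N ^ 2 / (4 * σ N ^ 2))) ∧
      ∑ j ∈ Finset.range (k N), ((k N).choose (k N - j) * (N - k N).choose (k N - j) : ℝ) *
        Real.exp (-(a j * Real.log N)) ≤ B) :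
    ExactRecoverySolvable μ σ k h := by
  choose Shat hmeas hmax using fun N => exists_measurable_estimator N (k N) (h N)
  refine ⟨Shat, hmeas, ?_⟩
  have hlog : Tendsto (fun N : ℕ => Real.log N) atTop atTop :=
    Real.tendsto_log_atTop.comp tendsto_natCast_atTop_atTop
  have hlim : Tendsto (fun N : ℕ => 1 - B / √(2 * Real.log N)) atTop (𝓝 (1 - 0)) := by
    refine tendsto_const_nhds.sub (tendsto_const_nhds.div_atTop ?_)
    exact Real.tendsto_sqrt_atTop.comp (hlog.const_mul_atTop two_pos)
  rw [sub_zero] at hlim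
  refine tendsto_of_tendsto_of_tendsto_of_le_of_le' hlim tendsto_const_nhds ?_ ?_
  · filter_upwards [hkN, hμ, hσ, H, hlog.eventually_gt_atTop 0] with N hkN hμ hσ ⟨a, ha, hB⟩ hL
    rw [hWSBM_real_eq _ _ (hmeas N)]
    have hcard : ((Finset.univ : Finset (Fin N)).powersetCard (k N)).card = N.choose (k N) := by
      rw [Finset.card_powersetCard, Finset.card_univ, Fintype.card_fin]
    have hC : (0 : ℝ) < N.choose (k N) := by exact_mod_cast Nat.choose_pos hkN
    rw [le_inv_mul_iff₀ hC, ← hcard, ← nsmul_eq_mul]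
    refine Finset.card_nsmul_le_sum _ _ _ fun S hS => ?_
    have hSk := (Finset.mem_powersetCard.mp hS).2
    set p := weightLaw N (h N) (μ N) (σ N) S
    have hsucc : MeasurableSet {E | Shat N E = S} := hmeas N (measurableSet_singleton S)
    have hsub : {E | Shat N E = S}ᶜ ⊆
        ⋃ S' ∈ (Finset.univ.powersetCard (k N)).filter (· ≠ S),
          {E | innerWeight S E ≤ innerWeight S' E} := by
      intro E hE
      by_contra hcon
      refine hE (hmax N S hS E fun S' hS' => ?_)
      simp only [Set.mem_iUnion, not_exists] at hcon
      exact not_le.mp (hcon S' hS')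
    have herr : p.real {E | Shat N E = S}ᶜ ≤ B / √(2 * Real.log N) := by
      calc _ ≤ _ := measureReal_mono hsub (measure_ne_top _ _)
        _ ≤ ∑ S' ∈ (Finset.univ.powersetCard (k N)).filter (· ≠ S),
            p.real {E | innerWeight S E ≤ innerWeight S' E} := measureReal_biUnion_finset_le _ _
        _ ≤ ∑ S' ∈ (Finset.univ.powersetCard (k N)).filter (· ≠ S),
            Real.exp (-(a (S ∩ S').card * Real.log N)) / √(2 * Real.log N) := by
            refine Finset.sum_le_sum fun S' hS' => ?_
            simp only [Finset.mem_filter, Finset.mem_powersetCard, Finset.subset_univ,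
              true_and] at hS'
            have hlt : (S ∩ S').card < k N := by
              rw [← hSk]
              refine Finset.card_lt_card (Finset.ssubset_iff_subset_ne.mpr
                ⟨Finset.inter_subset_left, fun heq => hS'.2 ?_⟩)
              exact (Finset.eq_of_subset_of_card_le (Finset.inter_eq_left.mp heq)
                (by omega)).symm
            have h1 := ha _ hlt
            -- Here `y₀ = log N`, allowed because `a j ≥ 1`; it gives every competitor the same
            -- vanishing prefactor.
            refine weightLaw_real_innerWeight_le hSk hS'.1 hμ hσ hL ?_ h1.2
            nlinarith [h1.1]
        _ ≤ _ := by
            rw [← Finset.sum_div]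
            gcongr
            exact (sum_inter_card_le hSk (fun j => Real.exp (-(a j * Real.log N)))
              fun j => (Real.exp_pos _).le).trans hB
    have := probReal_compl_eq_one_sub (μ := p) hsucc
    linarith
  · filter_upwards [hkN] with N hkN
    rw [hWSBM_real_eq _ _ (hmeas N)]
    have hC : (0 : ℝ) < N.choose (k N) := by exact_mod_cast Nat.choose_pos hkN
    rw [inv_mul_le_iff₀ hC, mul_one]
    calc _ ≤ ∑ S ∈ (Finset.univ : Finset (Fin N)).powersetCard (k N), (1 : ℝ) :=
          Finset.sum_le_sum fun S _ => measureReal_le_one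
      _ = _ := by simp

/-! ### Two solvability criteria -/

theorem sum_range_half_pow_le (k : ℕ) : ∑ j ∈ Finset.range k, (1 / 2 : ℝ) ^ (k - j) ≤ 1 := by
  have h1 : ∀ k : ℕ, ∑ j ∈ Finset.range k, (1 / 2 : ℝ) ^ (k - j) = 1 - (1 / 2) ^ k := by
    intro k
    induction k with
    | zero => simp
    | succ k ih =>
      rw [Finset.sum_range_succ']
      simp only [Nat.add_sub_add_right, ih, Nat.sub_zero]
      ring
  rw [h1]
  linarith [pow_pos (by norm_num : (0 : ℝ) < 1 / 2) k]

theorem exp_neg_natCast_mul_log {N : ℕ} (hN : 0 < N) (m : ℕ) :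
    Real.exp (-((m : ℝ) * Real.log N)) = ((N : ℝ) ^ m)⁻¹ := by
  rw [Real.exp_neg, Real.exp_nat_mul, Real.exp_log (by exact_mod_cast hN)]

/-- Solvability when every community swap is paid for by the number of choices of both the
removed and the added vertices. -/
theorem exactRecoverySolvable_of_four_le {μ σ : ℕ → ℝ} {k h : ℕ → ℕ}
    (hkh : ∀ᶠ N : ℕ in atTop, 2 ≤ h N ∧ h N ≤ k N ∧ k N ≤ N)
    (hμ : ∀ᶠ N : ℕ in atTop, 0 < μ N) (hσ : ∀ᶠ N : ℕ in atTop, 0 < σ N)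
    (H : ∀ᶠ N : ℕ in atTop, 2 * Real.log N ≤
      1 / (h N : ℝ) * (k N - 1).choose (h N - 1) * (μ N ^ 2 / (4 * σ N ^ 2))) :
    ExactRecoverySolvable μ σ k h := by
  refine exactRecoverySolvable_of_sum_le 1 (hkh.mono fun N hN => hN.2.2) hμ hσ ?_
  filter_upwards [hkh, H] with N ⟨hh, hhk, hkN⟩ hN
  have hh0 : (0 : ℝ) < h N := by exact_mod_cast (by omega : 0 < h N)
  -- Each swapped vertex earns `N⁻²`, against at most `k (N - k)` choices of a removed and an added
  -- vertex; the ratio is below `1/2` by AM-GM.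
  refine ⟨fun j => (2 * (k N - j) : ℕ), fun j hj => ⟨?_, ?_⟩, ?_⟩
  · change (1 : ℝ) ≤ ((2 * (k N - j) : ℕ) : ℝ)
    exact_mod_cast (by omega : 1 ≤ 2 * (k N - j))
  · have h1 := sub_mul_choose_le_mul_choose_sub_choose hj hh
    have hcast : ((2 * (k N - j) : ℕ) : ℝ) = 2 * ((k N : ℝ) - j) := by
      push_cast [hj.le]; rfl
    have hkj : (0 : ℝ) ≤ (k N : ℝ) - j := by
      rw [sub_nonneg]; exact_mod_cast hj.le
    beta_reduce
    rw [hcast]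
    set d : ℝ := (((k N - 1).choose (h N - 1) : ℕ) : ℝ)
    set r := μ N ^ 2 / (4 * σ N ^ 2)
    have hr : 0 ≤ r := by positivity
    calc 2 * ((k N : ℝ) - j) * Real.log N = ((k N : ℝ) - j) * (2 * Real.log N) := by ring
      _ ≤ ((k N : ℝ) - j) * (1 / (h N : ℝ) * d * r) := by gcongr
      _ = (((k N : ℝ) - j) * d) * (r / h N) := by ring
      _ ≤ (h N * (((k N).choose (h N) : ℝ) - j.choose (h N))) * (r / h N) := by gcongr
      _ = _ := by field_simp
  · refine le_trans (Finset.sum_le_sum fun j hj => ?_) (sum_range_half_pow_le (k N))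
    have hN0 : (0 : ℝ) < N := by exact_mod_cast (by omega : 0 < N)
    rw [exp_neg_natCast_mul_log (by omega), ← div_eq_mul_inv, div_le_iff₀ (by positivity),
      pow_mul, ← mul_pow]
    have h1 : ((k N).choose (k N - j) : ℝ) ≤ (k N : ℝ) ^ (k N - j) := by
      exact_mod_cast Nat.choose_le_pow _ _
    have h2 : ((N - k N).choose (k N - j) : ℝ) ≤ ((N - k N : ℕ) : ℝ) ^ (k N - j) := by
      exact_mod_cast Nat.choose_le_pow _ _
    calc _ ≤ (k N : ℝ) ^ (k N - j) * ((N - k N : ℕ) : ℝ) ^ (k N - j) := by gcongr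
      _ = ((k N : ℝ) * ((N - k N : ℕ) : ℝ)) ^ (k N - j) := (mul_pow _ _ _).symm
      _ ≤ _ := by
        refine pow_le_pow_left₀ (by positivity) ?_ _
        rw [Nat.cast_sub hkN]
        nlinarith [sq_nonneg ((N : ℝ) - 2 * k N)]

/-- By Vandermonde the counts sum to at most `C(N, k) ≤ N^k`. -/
theorem sum_choose_mul_choose_le {N k : ℕ} (hkN : k ≤ N) (hN : 0 < N) :
    ∑ j ∈ Finset.range k, (k.choose (k - j) * (N - k).choose (k - j) : ℝ) *
      ((N : ℝ) ^ k)⁻¹ ≤ 1 := by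
  have hN0 : (0 : ℝ) < N := by exact_mod_cast hN
  rw [← Finset.sum_mul, ← div_eq_mul_inv, div_le_one (by positivity)]
  have h1 : ∑ j ∈ Finset.range k, k.choose (k - j) * (N - k).choose (k - j) ≤ N.choose k := by
    have hV := Nat.add_choose_eq k (N - k) k
    rw [Nat.add_sub_cancel' hkN, Finset.Nat.sum_antidiagonal_eq_sum_range_succ
      (fun i j => k.choose i * (N - k).choose j), Finset.sum_range_succ] at hV
    rw [hV]
    refine le_trans (Finset.sum_le_sum fun j hj => ?_) (Nat.le_add_right _ _)
    rw [Nat.choose_symm (Finset.mem_range.mp hj).le]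
  exact_mod_cast h1.trans (Nat.choose_le_pow _ _)

/-- Solvability when the signal of a whole disjoint competitor pays for the choice of its `k`
vertices and the number of hyperedges at a vertex is small. -/
theorem exactRecoverySolvable_of_one_le {μ σ : ℕ → ℝ} {k h : ℕ → ℕ}
    (hkh : ∀ᶠ N : ℕ in atTop, 2 ≤ h N ∧ h N ≤ k N ∧ k N ≤ N)
    (hμ : ∀ᶠ N : ℕ in atTop, 0 < μ N) (hσ : ∀ᶠ N : ℕ in atTop, 0 < σ N)
    (hsmall : ∀ᶠ N : ℕ in atTop,
      1 / (h N : ℝ) * (k N - 1).choose (h N - 1) ≤ Real.log N / 4)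
    (H : ∀ᶠ N : ℕ in atTop, Real.log N ≤
      1 / (h N : ℝ) * (k N - 1).choose (h N - 1) * (μ N ^ 2 / (4 * σ N ^ 2))) :
    ExactRecoverySolvable μ σ k h := by
  refine exactRecoverySolvable_of_sum_le 2 (hkh.mono fun N hN => hN.2.2) hμ hσ ?_
  filter_upwards [hkh, hsmall, H, eventually_ge_atTop 16] with N ⟨hh, hhk, hkN⟩ hs hN hN16
  have hh0 : (0 : ℝ) < h N := by exact_mod_cast (by omega : 0 < h N)
  have hN0 : (0 : ℝ) < N := by exact_mod_cast (by omega : 0 < N)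
  have hN1 : (16 : ℝ) ≤ N := by exact_mod_cast hN16
  have hL : 0 < Real.log N := Real.log_pos (by linarith)
  set d : ℝ := (((k N - 1).choose (h N - 1) : ℕ) : ℝ) with hd_def
  have hd : 0 < d := by
    rw [hd_def]; exact_mod_cast Nat.choose_pos (by omega)
  set r := μ N ^ 2 / (4 * σ N ^ 2)
  have hr : 0 ≤ r := by positivity
  have hid : (k N : ℝ) * d = h N * (k N).choose (h N) :=
    choose_pred_mul (by omega) (by omega)
  -- The gap measured in units of `d/h`, each unit being worth at least one `log N`. It equals `k`
  -- when the overlap is too small to contain a hyperedge.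
  set a : ℕ → ℝ := fun j => h N * (((k N).choose (h N) : ℝ) - j.choose (h N)) / d with ha_def
  have ha_sub : ∀ j < k N, (k N : ℝ) - j ≤ a j := fun j hj => by
    rw [ha_def, le_div_iff₀ hd]
    exact sub_mul_choose_le_mul_choose_sub_choose hj hh
  have ha_succ : ∀ j, 1 ≤ j → j < k N → ((k N - j + 1 : ℕ) : ℝ) ≤ a j := fun j h1 hj => by
    have hcast : ((k N - j + 1 : ℕ) : ℝ) = (k N : ℝ) - j + 1 := by
      push_cast [hj.le]; rfl
    rw [hcast, ha_def, le_div_iff₀ hd]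
    exact le_mul_choose_sub_choose h1 hj hh
  have ha_top : ∀ j < h N, a j = k N := fun j hj => by
    simp only [ha_def, Nat.choose_eq_zero_of_lt hj, Nat.cast_zero, sub_zero]
    rw [← hid]
    field_simp
  have hexp : ∀ (j m : ℕ), (m : ℝ) ≤ a j →
      Real.exp (-(a j * Real.log N)) ≤ ((N : ℝ) ^ m)⁻¹ := fun j m hm => by
    rw [← exp_neg_natCast_mul_log (by omega)]
    gcongr
  refine ⟨a, fun j hj => ⟨?_, ?_⟩, ?_⟩
  · refine le_trans ?_ (ha_sub j hj)
    rw [le_sub_iff_add_le]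
    exact_mod_cast (by omega : 1 + j ≤ k N)
  · have hn : (0 : ℝ) ≤ ((k N).choose (h N) : ℝ) - j.choose (h N) := by
      rw [sub_nonneg]
      exact_mod_cast Nat.choose_le_choose _ hj.le
    calc a j * Real.log N ≤ a j * (1 / (h N : ℝ) * d * r) := by
          have : 0 ≤ a j := by positivity
          gcongr
      _ = _ := by rw [ha_def]; field_simp
  · have htop : ∀ j < h N, ((k N).choose (k N - j) * (N - k N).choose (k N - j) : ℝ) *
        Real.exp (-(a j * Real.log N)) ≤
        ((k N).choose (k N - j) * (N - k N).choose (k N - j) : ℝ) * ((N : ℝ) ^ k N)⁻¹ :=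
      fun j hj => mul_le_mul_of_nonneg_left (hexp j (k N) (ha_top j hj).ge) (by positivity)
    have hsum := sum_choose_mul_choose_le hkN (by omega : 0 < N)
    -- If `k ≥ h + 2`, then `k` is logarithmic and the terms with `j ≥ 1` add up to at most `2^k / N
    -- ≤ 1`. If `k ≤ h + 1`, every `j` except possibly `k - 1` is below `h`, so a single term needs
    -- separate care.
    rcases Nat.lt_or_ge (h N + 1) (k N) with hk2 | hk1
    · have hk0 : (0 : ℝ) < k N := by exact_mod_cast (by omega : 0 < k N)
      have hkL : (k N : ℝ) ≤ 1 + Real.log N / 2 := by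
        have h2 : ((k N).choose 2 : ℝ) ≤ (k N).choose (h N) := by
          exact_mod_cast choose_two_le_choose hh hk2
        rw [Nat.cast_choose_two] at h2
        have h3 : (h N : ℝ) * (k N * (k N - 1) / 2) ≤ k N * d := by rw [hid]; gcongr
        have h4 : ((k N : ℝ) - 1) / 2 ≤ 1 / (h N : ℝ) * d := by
          rw [one_div, le_inv_mul_iff₀ hh0]
          exact le_of_mul_le_mul_left (by linarith) hk0
        linarith
      have hpow : (2 : ℝ) ^ k N ≤ N := by
        have hlog2 : Real.log 2 ≤ 1 := by linarith [Real.log_two_lt_d9]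
        have hlog2' : 0 < Real.log 2 := Real.log_pos one_lt_two
        have hL2 : 4 * Real.log 2 ≤ Real.log N := by
          have : 4 * Real.log 2 = Real.log 16 := by
            rw [show (16 : ℝ) = 2 ^ 4 by norm_num, Real.log_pow]; norm_num
          rw [this]
          exact Real.log_le_log (by norm_num) hN1
        rw [← Real.log_le_log_iff (by positivity) hN0, Real.log_pow]
        nlinarith
      have hterm : ∀ j ∈ Finset.range (k N),
          ((k N).choose (k N - j) * (N - k N).choose (k N - j) : ℝ) *
            Real.exp (-(a j * Real.log N)) ≤
          ((k N).choose (k N - j) * (N - k N).choose (k N - j) : ℝ) * ((N : ℝ) ^ k N)⁻¹ +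
            (k N).choose j / N := by
        intro j hj
        have hjk := Finset.mem_range.mp hj
        rcases Nat.eq_zero_or_pos j with rfl | hj1
        · have := htop 0 (by omega)
          have h0 : (0 : ℝ) ≤ (k N).choose 0 / N := by positivity
          linarith
        · have h1 := hexp j _ (ha_succ j hj1 hjk)
          have h2 : ((N - k N).choose (k N - j) : ℝ) ≤ (N : ℝ) ^ (k N - j) := by
            refine le_trans (b := (((N - k N) ^ (k N - j) : ℕ) : ℝ)) ?_ ?_
            · exact_mod_cast Nat.choose_le_pow _ _
            · exact_mod_cast Nat.pow_le_pow_left (Nat.sub_le _ _) _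
          have h3 : (0 : ℝ) ≤
              ((k N).choose (k N - j) * (N - k N).choose (k N - j) : ℝ) * ((N : ℝ) ^ k N)⁻¹ := by
            positivity
          rw [← Nat.choose_symm hjk.le]
          calc _ ≤ ((k N).choose (k N - j) * (N : ℝ) ^ (k N - j)) *
                ((N : ℝ) ^ (k N - j + 1))⁻¹ := by gcongr
            _ = (k N).choose (k N - j) / N := by rw [pow_succ]; field_simp
            _ ≤ _ := le_add_of_nonneg_left h3
      refine (Finset.sum_le_sum hterm).trans ?_
      rw [Finset.sum_add_distrib, ← Finset.sum_div]
      have h5 : ∑ j ∈ Finset.range (k N), ((k N).choose j : ℝ) ≤ 2 ^ k N := by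
        have h6 := Nat.sum_range_choose (k N)
        rw [Finset.sum_range_succ] at h6
        exact_mod_cast (Nat.le_add_right _ _).trans h6.le
      have h7 : (∑ j ∈ Finset.range (k N), ((k N).choose j : ℝ)) / N ≤ 1 :=
        (div_le_one hN0).mpr (h5.trans hpow)
      linarith
    · have hterm : ∀ j ∈ Finset.range (k N),
          ((k N).choose (k N - j) * (N - k N).choose (k N - j) : ℝ) *
            Real.exp (-(a j * Real.log N)) ≤
          ((k N).choose (k N - j) * (N - k N).choose (k N - j) : ℝ) * ((N : ℝ) ^ k N)⁻¹ +
            if j = k N - 1 then 1 else 0 := by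
        intro j hj
        have hjk := Finset.mem_range.mp hj
        by_cases hjk1 : j = k N - 1
        · have h1 := hexp j _ (ha_succ j (by omega) hjk)
          rw [if_pos hjk1]
          have hkj : k N - j = 1 := by omega
          have h3 : (0 : ℝ) ≤
              ((k N).choose (k N - j) * (N - k N).choose (k N - j) : ℝ) * ((N : ℝ) ^ k N)⁻¹ := by
            positivity
          refine le_trans ?_ (le_add_of_nonneg_left h3)
          rw [hkj] at h1 ⊢
          rw [Nat.choose_one_right, Nat.choose_one_right]
          have h4 : (k N : ℝ) ≤ N := by exact_mod_cast hkN
          have h5 : ((N - k N : ℕ) : ℝ) ≤ N := by exact_mod_cast Nat.sub_le _ _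
          calc _ ≤ ((N : ℝ) * N) * ((N : ℝ) ^ (1 + 1))⁻¹ := by gcongr
            _ = 1 := by field_simp
        · rw [if_neg hjk1, add_zero]
          exact htop j (by omega)
      refine (Finset.sum_le_sum hterm).trans ?_
      rw [Finset.sum_add_distrib, Finset.sum_ite_eq']
      have : (if k N - 1 ∈ Finset.range (k N) then (1 : ℝ) else 0) ≤ 1 := by split_ifs <;> norm_num
      linarith

/-! ### Reduction of the thresholds to the criteria -/

theorem four_mul_lt_sq {x γ : ℝ} (hx : 0 ≤ x) (h : 2 * √x < γ) : 4 * x < γ ^ 2 := by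
  have h0 := Real.sqrt_nonneg x
  nlinarith [Real.sq_sqrt hx]

theorem signal_div_noise_eq {a b L : ℝ} (hb : b ≠ 0) (hL : 0 < L) :
    (a * L) ^ 2 / (4 * (b * √(L / 2)) ^ 2) = (a / b) ^ 2 * L / 2 := by
  rw [mul_pow b, Real.sq_sqrt (by positivity)]
  field_simp
  norm_num

theorem theorem6
    (k h : ℕ → ℕ) (μhat σhat γ : ℕ → ℝ)
    (hkh : ∀ᶠ N : ℕ in atTop, 2 ≤ h N ∧ h N ≤ k N ∧ k N ≤ N)
    (hμ : ∀ N, 0 < μhat N) (hσ : ∀ N, 0 < σhat N)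
    (hγ : ∀ N, γ N = μhat N / σhat N) :
    -- exact recovery is unsolvable below the lower threshold
    ((∀ᶠ N : ℕ in atTop, k N < N) →
      (∀ᶠ N : ℕ in atTop, γ N < √(1 / ((k N - 1).choose (h N - 1) : ℝ))) →
      ¬ ExactRecoverySolvable (fun N => μhat N * Real.log N)
          (fun N => σhat N * √(Real.log N / 2)) k h) ∧
    -- solvable above the upper threshold: the first regime
    (((fun N : ℕ => 1 / (h N : ℝ) * ((k N - 1).choose (h N - 1) : ℝ))
        =o[atTop] fun N : ℕ => Real.log N) →
      (∀ᶠ N : ℕ in atTop,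
        2 * √(((h N : ℝ) / 2) / ((k N - 1).choose (h N - 1) : ℝ)) < γ N) →
      ExactRecoverySolvable (fun N => μhat N * Real.log N)
          (fun N => σhat N * √(Real.log N / 2)) k h) ∧
    -- the second regime, with a finite limit `c`
    (∀ c : ℝ, 0 < c →
      Tendsto (fun N : ℕ => 1 / (h N : ℝ) * ((k N - 1).choose (h N - 1) : ℝ) / Real.log N)
        atTop (𝓝 c) →
      (∀ᶠ N : ℕ in atTop, 2 * √((1 + Real.log 2 + 1 / c) / Real.log N) < γ N) →
      ExactRecoverySolvable (fun N => μhat N * Real.log N)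
          (fun N => σhat N * √(Real.log N / 2)) k h) ∧
    -- the second regime, with `c = +∞`
    (Tendsto (fun N : ℕ => 1 / (h N : ℝ) * ((k N - 1).choose (h N - 1) : ℝ) / Real.log N)
        atTop atTop →
      (∀ᶠ N : ℕ in atTop, 2 * √((1 + Real.log 2) / Real.log N) < γ N) →
      ExactRecoverySolvable (fun N => μhat N * Real.log N)
          (fun N => σhat N * √(Real.log N / 2)) k h) ∧
    -- the third regime
    (∀ α : ℝ, 0 < α → α < 1 →
      ((fun N : ℕ => (k N : ℝ)) =O[atTop] fun N : ℕ => (N : ℝ) ^ α) →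
      ((fun N : ℕ => Real.log N)
        =o[atTop] fun N : ℕ => 1 / (h N : ℝ) * ((k N - 1).choose (h N - 1) : ℝ)) →
      (∀ᶠ N : ℕ in atTop, 2 * √((1 + Real.log 2) / ((1 - α) * Real.log N)) < γ N) →
      ExactRecoverySolvable (fun N => μhat N * Real.log N)
          (fun N => σhat N * √(Real.log N / 2)) k h) := by
  have hlog : ∀ᶠ N : ℕ in atTop, 0 < Real.log N :=
    (Real.tendsto_log_atTop.comp tendsto_natCast_atTop_atTop).eventually_gt_atTop 0
  have hμ' : ∀ᶠ N : ℕ in atTop, 0 < μhat N * Real.log N :=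
    hlog.mono fun N hN => mul_pos (hμ N) hN
  have hσ' : ∀ᶠ N : ℕ in atTop, 0 < σhat N * √(Real.log N / 2) :=
    hlog.mono fun N hN => mul_pos (hσ N) (Real.sqrt_pos.mpr (by linarith))
  have hγ0 : ∀ N, 0 < γ N := fun N => by rw [hγ]; exact div_pos (hμ N) (hσ N)
  have hd : ∀ᶠ N : ℕ in atTop, 0 < ((k N - 1).choose (h N - 1) : ℝ) ∧ (0 : ℝ) < h N := by
    filter_upwards [hkh] with N hN
    exact ⟨by exact_mod_cast Nat.choose_pos (by omega), by exact_mod_cast (by omega : 0 < h N)⟩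
  have hupper : (∀ᶠ N : ℕ in atTop,
      4 ≤ 1 / (h N : ℝ) * ((k N - 1).choose (h N - 1) : ℝ) * γ N ^ 2) →
      ExactRecoverySolvable (fun N => μhat N * Real.log N)
        (fun N => σhat N * √(Real.log N / 2)) k h := by
    intro H
    refine exactRecoverySolvable_of_four_le hkh hμ' hσ' ?_
    filter_upwards [H, hlog] with N hN hL
    rw [signal_div_noise_eq (hσ N).ne' hL, ← hγ]
    nlinarith
  -- Once `d/h ≥ log N`, any constant above 1 in the threshold yields `(d/h) γ² ≥ 4`; the case `c =
  -- +∞` and regime (iii) both have this form.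
  have hlarge : ∀ b : ℝ, 1 < b →
      (∀ᶠ N : ℕ in atTop,
        Real.log N ≤ 1 / (h N : ℝ) * ((k N - 1).choose (h N - 1) : ℝ)) →
      (∀ᶠ N : ℕ in atTop, 2 * √(b / Real.log N) < γ N) →
      ExactRecoverySolvable (fun N => μhat N * Real.log N)
        (fun N => σhat N * √(Real.log N / 2)) k h := by
    intro b hb h1 h2
    refine hupper ?_
    filter_upwards [h1, h2, hlog] with N h1 h2 hL
    have h3 := four_mul_lt_sq (by positivity) h2
    calc (4 : ℝ) ≤ 4 * b := by linarith
      _ = Real.log N * (4 * (b / Real.log N)) := by field_simp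
      _ ≤ _ := by gcongr
  have hlog2 : 0 < Real.log 2 := Real.log_pos one_lt_two
  refine ⟨fun hkN hlow => ?_, fun hsmall hup => ?_, fun c hc hlim hup => ?_, fun hlim hup => ?_,
    fun α hα0 hα1 _ hlittle hup => ?_⟩
  · refine not_exactRecoverySolvable ?_ (hσ'.mono fun N hN => hN.ne') ?_
    · filter_upwards [hkh, hkN] with N hN hN'
      exact ⟨by omega, hN.2.1, hN'⟩
    · filter_upwards [hlow, hlog, hd] with N hN hL ⟨hd, _⟩
      have h1 : γ N ^ 2 ≤ 1 / ((k N - 1).choose (h N - 1) : ℝ) := by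
        rw [← Real.sq_sqrt (show 0 ≤ 1 / ((k N - 1).choose (h N - 1) : ℝ) by positivity)]
        exact pow_le_pow_left₀ (hγ0 N).le hN.le 2
      rw [le_div_iff₀ hd] at h1
      have h2 : μhat N = γ N * σhat N := by rw [hγ, div_mul_cancel₀ _ (hσ N).ne']
      have hσN := hσ N
      rw [mul_pow (σhat N), Real.sq_sqrt (by positivity), h2]
      calc _ = γ N ^ 2 * ((k N - 1).choose (h N - 1) : ℝ) * (σhat N * Real.log N) ^ 2 := by ring
        _ ≤ 1 * (σhat N * Real.log N) ^ 2 := by gcongr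
        _ = _ := by ring
  · refine exactRecoverySolvable_of_one_le hkh hμ' hσ' ?_ ?_
    · filter_upwards [hsmall.bound (show (0 : ℝ) < 1 / 4 by norm_num), hlog] with N hN hL
      rw [Real.norm_of_nonneg hL.le] at hN
      linarith [Real.le_norm_self (1 / (h N : ℝ) * ((k N - 1).choose (h N - 1) : ℝ))]
    · filter_upwards [hup, hlog, hd] with N hN hL ⟨hd, hh⟩
      have h3 := four_mul_lt_sq (by positivity) hN
      rw [signal_div_noise_eq (hσ N).ne' hL, ← hγ]
      -- The threshold of regime (i) is exactly the value of `γ` at which one unit `d/h` of gap is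
      -- worth one `log N`.
      calc Real.log N = 1 / (h N : ℝ) * ((k N - 1).choose (h N - 1) : ℝ) *
            ((4 * (((h N : ℝ) / 2) / ((k N - 1).choose (h N - 1) : ℝ))) * Real.log N / 2) := by
              field_simp; norm_num
        _ ≤ _ := by gcongr
  · refine hupper ?_
    have hb : 0 < 1 + Real.log 2 + 1 / c := by positivity
    have h1 := hlim.mul_const (1 + Real.log 2 + 1 / c)
    -- The term `1/c` alone already accounts for the required 1; the rest is slack absorbing the
    -- convergence to `c`.
    have h2 : 1 < c * (1 + Real.log 2 + 1 / c) := by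
      have : c * (1 + Real.log 2 + 1 / c) = 1 + c * (1 + Real.log 2) := by field_simp; ring
      rw [this]
      have : 0 < c * (1 + Real.log 2) := by positivity
      linarith
    filter_upwards [h1.eventually_const_le h2, hup, hlog] with N h4 h5 hL
    have h3 := four_mul_lt_sq (by positivity) h5
    calc (4 : ℝ) ≤ 4 * (1 / (h N : ℝ) * ((k N - 1).choose (h N - 1) : ℝ) / Real.log N *
          (1 + Real.log 2 + 1 / c)) := by linarith
      _ = 1 / (h N : ℝ) * ((k N - 1).choose (h N - 1) : ℝ) *
          (4 * ((1 + Real.log 2 + 1 / c) / Real.log N)) := by ring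
      _ ≤ _ := by gcongr
  · refine hlarge (1 + Real.log 2) (by linarith) ?_ hup
    filter_upwards [hlim.eventually_ge_atTop 1, hlog] with N hN hL
    rwa [le_div_iff₀ hL, one_mul] at hN
  · refine hlarge ((1 + Real.log 2) / (1 - α)) ?_ ?_ ?_
    · rw [one_lt_div (by linarith)]
      linarith
    · filter_upwards [hlittle.bound one_pos, hlog, hd] with N hN hL ⟨hd, hh⟩
      rwa [one_mul, Real.norm_of_nonneg hL.le, Real.norm_of_nonneg (by positivity)] at hN
    · filter_upwards [hup] with N hN
      rwa [div_div]
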